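/- Let $r\ge 1$ and $N$ be integers with $r\le N/2$, and put $k=2r-1$. Write $N=kq+t$ with integers $q\ge 0$, $0\le t<k$, and let $\nu=(\nu_1,\dots,\nu_k)$ be the partition of $N$ with $\nu_1=\dots=\nu_t=q+1$ and $\nu_{t+1}=\dots=\nu_k=q$. Divide $\{1,\dots,N\}$ into the consecutive blocks $B_j=\{\nu_1+\dots+\nu_{j-1}+1,\dots,\nu_1+\dots+\nu_j\}$, $1\le j\le k$, and let $$p(x)=\prod_{j=1}^{k}\ \prod_{\substack{a<b\\ a,b\in B_j}}(x_a^2-x_b^2)\ \cdot\prod_{j=r+1}^{2r-1}\ \prod_{i\in B_j}x_i .$$ Let $K_{2r-1}\subset\mathbb{C}[x_1,\dots,x_N]$ be the ideal generated by the images of $p$ under all permutations of the variables $x_1,\dots,x_N$. Then for every $f\in K_{2r-1}$ the function $$\Psi(x)=\frac{f(x)}{\prod_{1\le i<j\le N}(x_i^2-x_j^2)^{1/(2r)}}$$ is locally $L^2$-integrable on $\mathbb{R}^N$, that is, every point of $\mathbb{R}^N$ has a neighbourhood $U$ with $\int_U|\Psi|^2\,dx<\infty$ (Lebesgue measure). Here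 the powers are taken with their principal values; another choice of roots does not change $|\Psi|$, and the values on the null set where the denominator vanishes are irrelevant. -/

import Mathlib

open MvPolynomial MeasureTheory Topology

/-- The Vandermonde product `∏_{a < b} (x_a - x_b)` in the variables with index in `B`;
it equals `1` if `B` has at most one element. -/
noncomputable def vandermondeOn {N : ℕ} (B : Finset (Fin N)) : MvPolynomial (Fin N) ℂ :=
  ∏ p ∈ B ×ˢ B with p.1 < p.2, (X p.1 - X p.2)

/-- For parts `ν = (ν_0, …, ν_{k-1})` (zero parts allowed), the block `j` of consecutive indices
`ν_0 + ⋯ + ν_{j-1} ≤ i < ν_0 + ⋯ + ν_j`, everything counted from `0`. -/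
def partBlock (N : ℕ) {k : ℕ} (ν : Fin k → ℕ) (j : Fin k) : Finset (Fin N) :=
  {i | ∑ a ∈ Finset.Iio j, ν a ≤ (i : ℕ) ∧ (i : ℕ) < ∑ a ∈ Finset.Iic j, ν a}

/-- The polynomial `p_ν(x)`: the product of the Vandermonde products of the blocks of `ν`. -/
noncomputable def partPoly (N : ℕ) {k : ℕ} (ν : Fin k → ℕ) : MvPolynomial (Fin N) ℂ :=
  ∏ j, vandermondeOn (partBlock N ν j)

/-- The polynomial `p_{ν,T}(x) = p_ν(x_1², …, x_N²) ∏_{j ∈ T} ∏_{i in block j} x_i`.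
(`expand 2` substitutes `x_i ↦ x_i²`.) -/
noncomputable def partPolyT (N : ℕ) {k : ℕ} (ν : Fin k → ℕ) (T : Finset (Fin k)) :
    MvPolynomial (Fin N) ℂ :=
  expand 2 (partPoly N ν) * ∏ j ∈ T, ∏ i ∈ partBlock N ν j, X i

/-- The ideal `K_{ν,T}` of `ℂ[x_1, …, x_N]` generated by the `S_N`-images of `p_{ν,T}`. -/
noncomputable def idealKPart (N : ℕ) {k : ℕ} (ν : Fin k → ℕ) (T : Finset (Fin k)) :
    Ideal (MvPolynomial (Fin N) ℂ) :=
  Ideal.span (Set.range fun σ : Equiv.Perm (Fin N) => rename σ (partPolyT N ν T))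

/-- The partition `ν_N^k = ((q+1)^t, q^{k-t})` of `N`, where `N = kq + t` and `0 ≤ t < k`. -/
def balancedPart (N k : ℕ) (j : Fin k) : ℕ :=
  if (j : ℕ) < N % k then N / k + 1 else N / k

/-- The set `T_{k,s}` of the last `s` of the `k` indices. -/
def lastIndices (k s : ℕ) : Finset (Fin k) :=
  {j | k ≤ (j : ℕ) + s}

/-- The ideal `K_{k,s} = K_{ν, T}` with `ν = ν_N^k` and `T = T_{k,s}`. -/
noncomputable def idealKTwo (N k s : ℕ) : Ideal (MvPolynomial (Fin N) ℂ) :=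
  idealKPart N (balancedPart N k) (lastIndices k s)

/-- For odd `k`, the ideal `K_k = K_{k, (k-1)/2}`. -/
noncomputable def idealK (N k : ℕ) : Ideal (MvPolynomial (Fin N) ℂ) :=
  idealKTwo N k ((k - 1) / 2)

/-- `Ψ` is locally `L²`-integrable on `ℝ^N` for Lebesgue measure: every point has a neighbourhood
`U` such that `Ψ` is measurable on `U` and `∫_U |Ψ|² < ∞`. -/
def LocallyL2 {N : ℕ} (Ψ : (Fin N → ℝ) → ℂ) : Prop :=
  ∀ P : Fin N → ℝ, ∃ U ∈ 𝓝 P, MemLp Ψ 2 (volume.restrict U)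

/-- The function `f / ∏_{i<j} (x_i² - x_j²)^{1/(2r)}` on `ℝ^N`, with principal values of the
complex powers (another choice of the roots multiplies the value at each point by a root of unity).
On the null set where the denominator vanishes the value is `0`. -/
noncomputable def dTypeQuotient {N : ℕ} (r : ℕ) (f : MvPolynomial (Fin N) ℂ) (x : Fin N → ℝ) : ℂ :=
  eval (fun i => (x i : ℂ)) f /
    ∏ p : Fin N × Fin N with p.1 < p.2,
      ((x p.1 : ℂ) ^ 2 - (x p.2 : ℂ) ^ 2) ^ ((1 : ℂ) / (2 * (r : ℂ)))

/-! The claim passes from generators to the ideal, because polynomial multipliers are bounded on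
balls and L² is closed under sums. For a generator, colour each variable by its block. Off the zero
sets, `|Ψ|²` is the product over pairs of `|x_i² - x_j²|` to the power `2·[same colour] - 1/r`,
times `|x_i|²` for each `i` with colour in `T`. Only the number `2r - 1` of colours and `|T| = r -
1` enter the estimates.

A signed permutation moves `x` to a chamber `0 < y_1 < ⋯ < y_N`, with gaps `u_i` as linear
coordinates. There `|y_i - y_j|`, `y_i + y_j` and `y_i` are each comparable to the largest gap that
they span, and it suffices to bound the product by a constant times `∏ u_i^{-c}` with `c = 1 -
1/(2r) < 1`, which is integrable near the origin. Taking logarithms, a layer-cake argument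
(`sum_weight_mul_min_nonneg`) reduces this bound to one inequality for each set `S` of small gaps.

Such an `S` groups the points into clusters. A cluster of `m` points uses `m - 1` gaps away from the
origin and `m` gaps at the origin, so `cluster_power_counting` leaves two inequalities in the colour
multiplicities `m_a` of one cluster. Away from the origin this is Cauchy–Schwarz together with `m_a
≤ m_a²` (`card_add_one_mul_sum_sq_ge`). At the origin it is a quadratic estimate in which
integrality of the `m_a` is essential (`sq_sum_le_mul_signed_sum`). -/

/-! ### Layer-cake comparison. -/

lemma setIntegral_indicator_Iio_one {τ T : ℝ} (h0 : 0 ≤ τ) (hT : τ ≤ T) :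
    ∫ s in Set.Ioc 0 T, (Set.Iio τ).indicator (fun _ => (1 : ℝ)) s = τ := by
  rw [setIntegral_indicator measurableSet_Iio]
  have : Set.Ioc 0 T ∩ Set.Iio τ = Set.Ioo 0 τ := by
    ext s
    simp only [Set.mem_inter_iff, Set.mem_Ioc, Set.mem_Iio, Set.mem_Ioo]
    constructor
    · rintro ⟨⟨h1, h2⟩, h3⟩; exact ⟨h1, h3⟩
    · rintro ⟨h1, h2⟩; exact ⟨⟨h1, by linarith⟩, h2⟩
  rw [this]
  simp [h0]

lemma integrableOn_indicator_Iio_one (τ T : ℝ) :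
    IntegrableOn (fun s => (Set.Iio τ).indicator (fun _ => (1 : ℝ)) s) (Set.Ioc 0 T) :=
  (integrable_const (1 : ℝ)).indicator measurableSet_Iio

/-- Layer-cake comparison: a bound on the total weight of the index sets inside each `S` passes to
the weighted sum of the minima of a nonnegative function over these index sets. -/
lemma sum_weight_mul_min_nonneg {ι κ : Type*} [Fintype ι] [DecidableEq ι] [Fintype κ]
    (A : κ → Finset ι) (w : κ → ℝ) (c : ℝ)
    (hS : ∀ S : Finset ι, 0 ≤ (∑ k, if A k ⊆ S then w k else 0) + c * (S.card : ℝ))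
    (t : ι → ℝ) (ht : ∀ i, 0 ≤ t i) (g : κ → ι)
    (hg : ∀ k, w k ≠ 0 → g k ∈ A k ∧ ∀ i ∈ A k, t (g k) ≤ t i) :
    0 ≤ (∑ k, w k * t (g k)) + c * ∑ i, t i := by
  -- A common upper bound for the `t i`, so that all layers lie in the bounded interval `(0, T]`.
  set T := ∑ i, t i
  have hT : ∀ i, t i ≤ T := fun i => Finset.single_le_sum (fun j _ => ht j) (Finset.mem_univ i)
  let χ : ℝ → ℝ → ℝ := fun τ s => (Set.Iio τ).indicator (fun _ => (1 : ℝ)) s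
  have hint : ∀ i, ∫ s in Set.Ioc 0 T, χ (t i) s = t i :=
    fun i => setIntegral_indicator_Iio_one (ht i) (hT i)
  have hi : ∀ i, IntegrableOn (χ (t i)) (Set.Ioc 0 T) :=
    fun i => integrableOn_indicator_Iio_one _ _
  have key : (∑ k, w k * t (g k)) + c * ∑ i, t i
      = ∫ s in Set.Ioc 0 T, ((∑ k, w k * χ (t (g k)) s) + c * ∑ i, χ (t i) s) := by
    rw [integral_add, integral_finsetSum, integral_const_mul, integral_finsetSum]
    · simp_rw [integral_const_mul, hint]
    · exact fun i _ => hi i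
    · exact fun k _ => (hi _).const_mul _
    · exact integrable_finsetSum _ fun k _ => (hi _).const_mul _
    · exact (integrable_finsetSum _ fun i _ => hi i).const_mul _
  rw [key]
  refine integral_nonneg fun s => ?_
  -- A minimum over `A k` exceeds `s` exactly when `A k` lies in the superlevel set `{t > s}`, so
  -- the integrand at height `s` is the hypothesis for that set.
  have h := hS {i | s < t i}
  have e1 : (∑ k, w k * χ (t (g k)) s)
      = ∑ k, if A k ⊆ ({i | s < t i} : Finset ι) then w k else 0 := by
    refine Finset.sum_congr rfl fun k _ => ?_
    by_cases hw : w k = 0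
    · simp [hw]
    obtain ⟨h1, h2⟩ := hg k hw
    have : A k ⊆ ({i | s < t i} : Finset ι) ↔ s < t (g k) := by
      constructor
      · intro h; simpa using h h1
      · intro h i hi; simpa using h.trans_le (h2 i hi)
    simp only [this, χ, Set.indicator_apply, Set.mem_Iio, mul_ite, mul_one, mul_zero]
  have e2 : (∑ i, χ (t i) s) = ((({i | s < t i} : Finset ι)).card : ℝ) := by
    simp [χ, Set.indicator_apply, Finset.sum_boole]
  simp only [Pi.zero_apply]
  rw [e1, e2]
  exact h

/-! ### Clusters of points and power counting. -/

section Clusters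

variable {N : ℕ}

/-- The number of elements of `Iic i` outside `S`; its fibres are the clusters of points joined by
the gaps in `S`. -/
def clusterIndex (S : Finset (Fin N)) (i : Fin N) : ℕ := (Finset.Iic i \ S).card

lemma clusterIndex_mono (S : Finset (Fin N)) : Monotone (clusterIndex S) := fun _ _ h =>
  Finset.card_le_card (Finset.sdiff_subset_sdiff (Finset.Iic_subset_Iic.2 h) le_rfl)

lemma clusterIndex_eq_zero_iff (S : Finset (Fin N)) (i : Fin N) :
    clusterIndex S i = 0 ↔ Finset.Iic i ⊆ S := by
  simp [clusterIndex, Finset.sdiff_eq_empty_iff_subset]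

lemma clusterIndex_eq_iff (S : Finset (Fin N)) {i j : Fin N} (h : i ≤ j) :
    clusterIndex S i = clusterIndex S j ↔ Finset.Ioc i j ⊆ S := by
  have hsub : Finset.Iic i \ S ⊆ Finset.Iic j \ S :=
    Finset.sdiff_subset_sdiff (Finset.Iic_subset_Iic.2 h) le_rfl
  constructor
  · intro he g hg
    by_contra hgS
    have := Finset.eq_of_subset_of_card_le hsub he.ge
    have hm : g ∈ Finset.Iic j \ S := by
      simp only [Finset.mem_sdiff, Finset.mem_Iic]; exact ⟨(Finset.mem_Ioc.1 hg).2, hgS⟩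
    rw [← this] at hm
    simp only [Finset.mem_sdiff, Finset.mem_Iic] at hm
    exact absurd (Finset.mem_Ioc.1 hg).1 (not_lt.2 hm.1)
  · intro hs
    unfold clusterIndex
    congr 1
    refine Finset.Subset.antisymm hsub fun g hg => ?_
    simp only [Finset.mem_sdiff, Finset.mem_Iic] at hg ⊢
    refine ⟨not_lt.1 fun hlt => hg.2 (hs (Finset.mem_Ioc.2 ⟨hlt, hg.1⟩)), hg.2⟩

lemma clusterIndex_lt (S : Finset (Fin N)) {i j : Fin N} (h : i < j) (hj : j ∉ S) :
    clusterIndex S i < clusterIndex S j := by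
  refine lt_of_le_of_ne (clusterIndex_mono S h.le) fun he => hj ?_
  exact (clusterIndex_eq_iff S h.le).1 he (Finset.mem_Ioc.2 ⟨h, le_rfl⟩)

/-- Each large gap `i ∉ S` starts a new cluster, with nonzero index. Index `0` is reserved for
points joined to the origin. -/
lemma card_compl_le_card_clusters (S : Finset (Fin N)) :
    (Sᶜ).card ≤ ((Finset.univ.image (clusterIndex S)).erase 0).card := by
  refine Finset.card_le_card_of_injOn (clusterIndex S) ?_ ?_
  · intro i hi
    have hi : i ∉ S := by simpa using hi
    simp only [Finset.coe_erase, Finset.coe_image, Finset.coe_univ, Set.image_univ]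
    refine ⟨⟨i, rfl⟩, fun h0 => hi ?_⟩
    exact (clusterIndex_eq_zero_iff S i).1 h0 (Finset.mem_Iic.2 le_rfl)
  · intro i hi j hj he
    have hi : i ∉ S := by simpa using hi
    have hj : j ∉ S := by simpa using hj
    rcases lt_trichotomy i j with h | h | h
    · exact absurd he (clusterIndex_lt S h hj).ne
    · exact h
    · exact absurd he (clusterIndex_lt S h hi).ne'

/-- Power counting over all clusters, from power counting over one cluster. -/
lemma cluster_power_counting (e : Fin N → Fin N → ℝ) (τ : Fin N → ℝ) (c : ℝ) (hc : 0 ≤ c)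
    (h1 : ∀ I : Finset (Fin N), I.Nonempty →
      -(2 * c * ((I.card : ℝ) - 1)) ≤ ∑ i ∈ I, ∑ j ∈ I, e i j)
    (h2 : ∀ I : Finset (Fin N),
      -(c * (I.card : ℝ)) ≤ (∑ i ∈ I, ∑ j ∈ I, e i j) + ∑ i ∈ I, τ i)
    (S : Finset (Fin N)) :
    0 ≤ (∑ i, ∑ j, if Finset.Ioc (min i j) (max i j) ⊆ S then e i j / 2 else 0)
      + (∑ i, ∑ j, if Finset.Iic (max i j) ⊆ S then e i j / 2 else 0)
      + (∑ i, if Finset.Iic i ⊆ S then τ i else 0) + c * (S.card : ℝ) := by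
  classical
  set γ := clusterIndex S
  let F : ℕ → Finset (Fin N) := fun v => {i | γ i = v}
  let Q : Finset (Fin N) → ℝ := fun I => ∑ i ∈ I, ∑ j ∈ I, e i j
  have hQ : ∀ v, Q (F v) = ∑ i, ∑ j, if γ i = v ∧ γ j = v then e i j else 0 := by
    intro v
    simp only [Q, F, Finset.sum_filter]
    refine Finset.sum_congr rfl fun i _ => ?_
    by_cases h : γ i = v <;> simp [h]
  have hmin : ∀ i j : Fin N, Finset.Ioc (min i j) (max i j) ⊆ S ↔ γ i = γ j := by
    intro i j
    rcases le_total i j with h | h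
    · rw [min_eq_left h, max_eq_right h, ← clusterIndex_eq_iff S h]
    · rw [min_eq_right h, max_eq_left h, ← clusterIndex_eq_iff S h, eq_comm]
  have hmax : ∀ i j : Fin N, Finset.Iic (max i j) ⊆ S ↔ γ i = 0 ∧ γ j = 0 := by
    intro i j
    rw [← clusterIndex_eq_zero_iff]
    have := (clusterIndex_mono S).map_max (a := i) (b := j)
    rw [this]
    change max (γ i) (γ j) = 0 ↔ _
    omega
  -- The origin cluster may be empty, so `0` need not lie in `V`. Hence the index set `insert 0
  -- (V.erase 0)` below.
  set V := Finset.univ.image γ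
  have hV : ∀ i, γ i ∈ V := fun i => Finset.mem_image_of_mem _ (Finset.mem_univ i)
  have s1 : (∑ i, ∑ j, if Finset.Ioc (min i j) (max i j) ⊆ S then e i j / 2 else 0)
      = ∑ v ∈ insert 0 (V.erase 0), Q (F v) / 2 := by
    simp_rw [hQ, Finset.sum_div]
    rw [Finset.sum_comm (s := insert 0 (V.erase 0))]
    refine Finset.sum_congr rfl fun i _ => ?_
    rw [Finset.sum_comm (s := insert 0 (V.erase 0))]
    refine Finset.sum_congr rfl fun j _ => ?_
    have hmem : γ i ∈ insert 0 (V.erase 0) := by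
      by_cases h : γ i = 0
      · simp [h]
      · simp [h, hV]
    rw [Finset.sum_eq_single_of_mem _ hmem]
    · simp only [hmin, true_and, eq_comm, ite_div, zero_div]
    · intro v _ hv
      simp [hv.symm]
  have s2 : (∑ i, ∑ j, if Finset.Iic (max i j) ⊆ S then e i j / 2 else 0) = Q (F 0) / 2 := by
    simp_rw [hQ, Finset.sum_div, hmax, ite_div, zero_div]
  have s3 : (∑ i, if Finset.Iic i ⊆ S then τ i else 0) = ∑ i ∈ F 0, τ i := by
    simp_rw [← clusterIndex_eq_zero_iff, F, Finset.sum_filter]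
    rfl
  have b0 := h2 (F 0)
  -- Away from the origin only the factors `|y_i - y_j|` are small, giving `Q / 2`. At the origin
  -- `y_i + y_j` is small too and contributes the other half.
  have b1 : ∑ v ∈ V.erase 0, (-(c * (((F v).card : ℝ) - 1))) ≤ ∑ v ∈ V.erase 0, Q (F v) / 2 := by
    refine Finset.sum_le_sum fun v hv => ?_
    obtain ⟨i, -, hi⟩ := Finset.mem_image.1 (Finset.mem_of_mem_erase hv)
    have := h1 (F v) ⟨i, by simp [F, hi]⟩
    change _ ≤ Q (F v) at this
    linarith
  have b2 : (N : ℝ) = ((F 0).card : ℝ) + ∑ v ∈ V.erase 0, ((F v).card : ℝ) := by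
    rw [← Finset.sum_insert (f := fun v => ((F v).card : ℝ)) (by simp)]
    have : (Finset.univ : Finset (Fin N)).card = ∑ v ∈ insert 0 (V.erase 0), (F v).card := by
      refine Finset.card_eq_sum_card_fiberwise fun i _ => ?_
      by_cases h : γ i = 0
      · simp [h]
      · simp [h, hV]
    rw [Finset.card_univ, Fintype.card_fin] at this
    exact_mod_cast this
  have b3 : (N : ℝ) ≤ S.card + ((V.erase 0).card : ℝ) := by
    have h := card_compl_le_card_clusters S
    have h' := Finset.card_add_card_compl S
    rw [Fintype.card_fin] at h'
    have : N ≤ S.card + (V.erase 0).card := by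
      change _ ≤ (V.erase 0).card at h
      omega
    exact_mod_cast this
  rw [s1, s2, s3, Finset.sum_insert (by simp)]
  rw [Finset.sum_neg_distrib, ← Finset.mul_sum, Finset.sum_sub_distrib, Finset.sum_const,
    nsmul_eq_mul, mul_one] at b1
  have := mul_le_mul_of_nonneg_left b3 hc
  rw [b2] at this
  change _ ≤ Q (F 0) + _ at b0
  linarith

end Clusters

/-! ### From exponent counting to a pointwise bound in the gaps. -/

lemma mul_log_le_of_comparable {a L K : ℝ} (w : ℝ) (ha : 0 < a) (h1 : a ≤ L) (h2 : L ≤ K * a) :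
    w * Real.log L ≤ w * Real.log a + |w| * Real.log K := by
  have hL : 0 < L := ha.trans_le h1
  have hK : 0 < K := by
    by_contra h
    have := mul_nonpos_of_nonpos_of_nonneg (not_lt.1 h) ha.le
    linarith
  have l1 : Real.log a ≤ Real.log L := Real.log_le_log ha h1
  have l2 : Real.log L ≤ Real.log K + Real.log a := by
    rw [← Real.log_mul hK.ne' ha.ne']; exact Real.log_le_log hL h2
  have h3 : w * (Real.log L - Real.log a) ≤ |w| * Real.log K :=
    (le_abs_self _).trans <| by
      rw [abs_mul]
      refine mul_le_mul_of_nonneg_left ?_ (abs_nonneg w)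
      rw [abs_of_nonneg (by linarith)]; linarith
  linarith

/-- The layer-cake inequality applied to `t_i = log (R / u_i) ≥ 0`, for which minima of `t` are
maxima of `u`. The witness `g` stands outside the implication so that it can be chosen for every
`k`, including those of weight zero with empty `A k`. -/
lemma exists_sum_log_le {ι κ : Type*} [Fintype ι] [DecidableEq ι] [Fintype κ]
    (A : κ → Finset ι) (w : κ → ℝ) (c : ℝ)
    (hS : ∀ S : Finset ι, 0 ≤ (∑ k, if A k ⊆ S then w k else 0) + c * (S.card : ℝ))
    (K R : ℝ) :
    ∃ C : ℝ, ∀ u : ι → ℝ, (∀ i, 0 < u i ∧ u i ≤ R) → ∀ L : κ → ℝ,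
      (∀ k, ∃ g, w k ≠ 0 → g ∈ A k ∧ (∀ i ∈ A k, u i ≤ u g) ∧ u g ≤ L k ∧ L k ≤ K * u g) →
      ∑ k, w k * Real.log (L k) ≤ C - c * ∑ i, Real.log (u i) := by
  refine ⟨(∑ k, w k) * Real.log R + c * (Fintype.card ι * Real.log R)
    + (∑ k, |w k|) * Real.log K, fun u hu L hL => ?_⟩
  choose g hg using hL
  have h := sum_weight_mul_min_nonneg A w c hS (fun i => Real.log R - Real.log (u i))
    (fun i => sub_nonneg.2 (Real.log_le_log (hu i).1 (hu i).2)) g (fun k hk => ⟨(hg k hk).1,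
      fun i hi => sub_le_sub_left (Real.log_le_log (hu i).1 ((hg k hk).2.1 i hi)) _⟩)
  have h2 : ∑ k, w k * Real.log (L k)
      ≤ ∑ k, (w k * Real.log (u (g k)) + |w k| * Real.log K) := by
    refine Finset.sum_le_sum fun k _ => ?_
    by_cases hk : w k = 0
    · simp [hk]
    · exact mul_log_le_of_comparable _ (hu _).1 (hg k hk).2.2.1 (hg k hk).2.2.2
  simp only [mul_sub, Finset.sum_sub_distrib, Finset.sum_add_distrib, ← Finset.sum_mul,
    Finset.sum_const, Finset.card_univ, nsmul_eq_mul] at h h2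
  linarith

lemma exists_max_comparable_sum {ι : Type*} (A : Finset ι) (hA : A.Nonempty) (u : ι → ℝ)
    (hu : ∀ i, 0 < u i) :
    ∃ g ∈ A, (∀ i ∈ A, u i ≤ u g) ∧ u g ≤ ∑ i ∈ A, u i ∧ ∑ i ∈ A, u i ≤ A.card * u g := by
  obtain ⟨g, hg, hmax⟩ := A.exists_max_image u hA
  refine ⟨g, hg, hmax, Finset.single_le_sum (fun i _ => (hu i).le) hg, ?_⟩
  have := Finset.sum_le_card_nsmul A u (u g) hmax
  rwa [nsmul_eq_mul] at this

/-- Pointwise bound of a type `B` product of differences of partial sums by a product of gaps. -/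
lemma exists_log_partial_sum_bound {N : ℕ} (e : Fin N → Fin N → ℝ) (τ : Fin N → ℝ) (c : ℝ)
    (hc : 0 ≤ c) (he : ∀ i, e i i = 0)
    (h1 : ∀ I : Finset (Fin N), I.Nonempty →
      -(2 * c * ((I.card : ℝ) - 1)) ≤ ∑ i ∈ I, ∑ j ∈ I, e i j)
    (h2 : ∀ I : Finset (Fin N),
      -(c * (I.card : ℝ)) ≤ (∑ i ∈ I, ∑ j ∈ I, e i j) + ∑ i ∈ I, τ i)
    (R : ℝ) :
    ∃ C : ℝ, ∀ u : Fin N → ℝ, (∀ i, 0 < u i ∧ u i ≤ R) → ∀ y : Fin N → ℝ,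
      (∀ i, y i = ∑ g ∈ Finset.Iic i, u g) →
      (∑ i, ∑ j, e i j / 2 * Real.log |y i ^ 2 - y j ^ 2|) + ∑ i, τ i * Real.log (y i)
        ≤ C - c * ∑ i, Real.log (u i) := by
  -- Three kinds of factors: differences `|y_i - y_j|`, sums `y_i + y_j`, and single coordinates,
  -- each with the set of gaps that governs its size.
  let κ := (Fin N × Fin N) ⊕ ((Fin N × Fin N) ⊕ Fin N)
  let A : κ → Finset (Fin N) := Sum.elim (fun p => Finset.Ioc (min p.1 p.2) (max p.1 p.2))
    (Sum.elim (fun p => Finset.Iic (max p.1 p.2)) fun i => Finset.Iic i)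
  let w : κ → ℝ := Sum.elim (fun p => e p.1 p.2 / 2) (Sum.elim (fun p => e p.1 p.2 / 2) τ)
  obtain ⟨C, hC⟩ := exists_sum_log_le A w c (fun S => by
    have := cluster_power_counting e τ c hc h1 h2 S
    refine this.trans_eq ?_
    simp only [κ, Fintype.sum_sum_type, Fintype.sum_prod_type, ← add_assoc]
    rfl) (2 * N) R
  refine ⟨C, fun u hu y hy => ?_⟩
  have hcard : ∀ (B : Finset (Fin N)) (g : Fin N), (B.card : ℝ) * u g ≤ N * u g := fun B g =>
    mul_le_mul_of_nonneg_right (by exact_mod_cast card_finset_fin_le B) (hu g).1.le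
  have hNu : ∀ g : Fin N, 0 ≤ N * u g := fun g => mul_nonneg N.cast_nonneg (hu g).1.le
  have hmono : Monotone y := fun i j hij => by
    rw [hy, hy]
    exact Finset.sum_le_sum_of_subset_of_nonneg (Finset.Iic_subset_Iic.2 hij)
      fun g _ _ => (hu g).1.le
  have hpos : ∀ i, 0 < y i := fun i => by
    rw [hy]; exact Finset.sum_pos (fun g _ => (hu g).1) ⟨i, by simp⟩
  have hdiff' : ∀ i j : Fin N, i ≤ j → ∑ g ∈ Finset.Ioc i j, u g = y j - y i := fun i j hij => by
    have : Finset.Ioc i j = Finset.Iic j \ Finset.Iic i := by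
      ext g; simp [and_comm]
    rw [this, hy, hy, eq_sub_iff_add_eq]
    exact Finset.sum_sdiff (Finset.Iic_subset_Iic.2 hij)
  have hdiff : ∀ i j : Fin N, ∑ g ∈ Finset.Ioc (min i j) (max i j), u g = |y i - y j| := by
    intro i j
    rcases le_total i j with h | h
    · rw [min_eq_left h, max_eq_right h, hdiff' i j h, abs_sub_comm,
        abs_of_nonneg (sub_nonneg.2 (hmono h))]
    · rw [min_eq_right h, max_eq_left h, hdiff' j i h, abs_of_nonneg (sub_nonneg.2 (hmono h))]
  have hIic : ∀ i : Fin N, ∃ g ∈ Finset.Iic i, (∀ k ∈ Finset.Iic i, u k ≤ u g) ∧ u g ≤ y i ∧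
      y i ≤ N * u g := fun i => by
    obtain ⟨g, h1, h2, h3, h4⟩ := exists_max_comparable_sum (Finset.Iic i) ⟨i, by simp⟩ u
      fun k => (hu k).1
    rw [← hy] at h3 h4
    exact ⟨g, h1, h2, h3, h4.trans (hcard _ _)⟩
  have hne : ∀ i j, i ≠ j → 0 < |y i - y j| := fun i j hij => by
    rw [← hdiff]
    refine Finset.sum_pos (fun g _ => (hu g).1) ?_
    exact Finset.nonempty_Ioc.2 (min_lt_max.2 hij)
  have key := hC u hu (Sum.elim (fun p => |y p.1 - y p.2|)
    (Sum.elim (fun p => y p.1 + y p.2) y)) (by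
      rintro (⟨i, j⟩ | ⟨i, j⟩ | i)
      -- On the diagonal the set of gaps is empty, but the weight vanishes.
      · by_cases hij : i = j
        · refine ⟨i, fun h => (h ?_).elim⟩
          simp [w, hij, he]
        · obtain ⟨g, h1, h2, h3, h4⟩ := exists_max_comparable_sum
            (Finset.Ioc (min i j) (max i j)) (Finset.nonempty_Ioc.2 (min_lt_max.2 hij)) u
            fun k => (hu k).1
          rw [hdiff] at h3 h4
          refine ⟨g, fun _ => ⟨h1, h2, h3, ?_⟩⟩
          have := hcard (Finset.Ioc (min i j) (max i j)) g
          have := hNu g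
          change |y i - y j| ≤ _
          linarith
      · obtain ⟨g, h1, h2, h3, h4⟩ := hIic (max i j)
        refine ⟨g, fun _ => ⟨h1, h2, ?_, ?_⟩⟩
        · change _ ≤ y i + y j
          rcases max_choice i j with h | h <;> rw [h] at h3
          · linarith [hpos j]
          · linarith [hpos i]
        · change y i + y j ≤ _
          linarith [hmono (le_max_left i j), hmono (le_max_right i j)]
      · obtain ⟨g, h1, h2, h3, h4⟩ := hIic i
        refine ⟨g, fun _ => ⟨h1, h2, h3, ?_⟩⟩
        change y i ≤ _
        linarith [hNu g])
  refine le_trans (le_of_eq ?_) key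
  simp only [κ, w, Fintype.sum_sum_type, Fintype.sum_prod_type, Sum.elim_inl, Sum.elim_inr,
    ← add_assoc]
  rw [add_left_inj]
  simp only [← Finset.sum_add_distrib]
  refine Finset.sum_congr rfl fun i _ => Finset.sum_congr rfl fun j _ => ?_
  by_cases hij : i = j
  · simp [hij, he]
  · rw [← mul_add, ← Real.log_mul (hne i j hij).ne' (by linarith [hpos i, hpos j])]
    have habs : |y i ^ 2 - y j ^ 2| = |y i - y j| * (y i + y j) := by
      rw [← abs_of_pos (add_pos (hpos i) (hpos j)), ← abs_mul]
      congr 1; ring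
    rw [habs]

/-! ### Inequalities for colour multiplicities. -/

section Counting

variable {κ : Type*} [Fintype κ]

lemma card_add_one_mul_sum_sq_ge (m : κ → ℕ) (hm : 1 ≤ ∑ a, m a) (hκ : 0 < Fintype.card κ) :
    (∑ a, (m a : ℤ)) ^ 2 + Fintype.card κ ≤ (Fintype.card κ + 1) * ∑ a, (m a : ℤ) ^ 2 := by
  have hlin : (∑ a, (m a : ℤ)) ≤ ∑ a, (m a : ℤ) ^ 2 := Finset.sum_le_sum fun a _ => by
    have : m a ≤ m a ^ 2 := Nat.le_self_pow two_ne_zero _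
    exact_mod_cast this
  have hcs := sq_sum_le_card_mul_sum_sq (s := (Finset.univ : Finset κ)) (f := fun a => (m a : ℤ))
  rw [Finset.card_univ] at hcs
  have hm' : (1 : ℤ) ≤ ∑ a, (m a : ℤ) := by exact_mod_cast hm
  have hκ' : (0 : ℤ) < Fintype.card κ := by exact_mod_cast hκ
  generalize (∑ a, (m a : ℤ)) = M at *
  generalize (∑ a, (m a : ℤ) ^ 2) = Q at *
  generalize (Fintype.card κ : ℤ) = k at *
  -- For `M ≤ k`, `Q ≥ M` reduces the claim to `(M - 1)(k - M) ≥ 0`. For `M ≥ k`, Cauchy–Schwarz `k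
  -- Q ≥ M²` reduces it to `M² ≥ k²`.
  rcases le_total M k with h | h
  · nlinarith [mul_nonneg (sub_nonneg.2 hm') (sub_nonneg.2 h)]
  · have h3 : k ^ 2 ≤ M ^ 2 := pow_le_pow_left₀ hκ'.le h 2
    have h4 : 0 ≤ k * ((k + 1) * Q - (M ^ 2 + k)) := by nlinarith
    linarith [nonneg_of_mul_nonneg_right h4 hκ']

variable [DecidableEq κ]

/-- The right side is `r` times a sum of terms `2m² + m` on `T` and `2m² - m` off `T`. Each is
bounded below by a line of slope `2l + 1`, where `l = ⌊M / r⌋`, and integrality lets the constants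
be rounded down. With `M = r l + d` the resulting bound exceeds `M²` by `d (r - d) ≥ 0`. -/
lemma sq_sum_le_mul_signed_sum (m : κ → ℕ) (T : Finset κ) (r : ℕ) (hr : 0 < r)
    (hT : T.card + 1 = r) (hκ : Fintype.card κ + 1 = 2 * r) :
    (∑ a, (m a : ℤ)) ^ 2
      ≤ r * (2 * (∑ a, (m a : ℤ) ^ 2) - (∑ a, (m a : ℤ)) + 2 * ∑ a ∈ T, (m a : ℤ)) := by
  set M : ℕ := ∑ a, m a with hM
  have hMc : (∑ a, (m a : ℤ)) = M := by rw [hM]; push_cast; rfl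
  obtain ⟨l, d, hd, hMl⟩ : ∃ l d : ℕ, d < r ∧ M = r * l + d :=
    ⟨M / r, M % r, Nat.mod_lt _ hr, (Nat.div_add_mod M r).symm⟩
  have hTc : (Tᶜ.card : ℤ) = r := by
    have := Finset.card_add_card_compl T
    omega
  have hT' : (T.card : ℤ) = r - 1 := by omega
  have p1 : ∀ a ∈ T, (2 * l + 1) * (m a : ℤ) - (l : ℤ) ^ 2 / 2 ≤ 2 * (m a : ℤ) ^ 2 + m a := by
    intro a _
    have h : 0 ≤ (2 * (m a : ℤ) - l) ^ 2 := sq_nonneg _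
    have h' : -((l : ℤ) ^ 2) ≤ 2 * (2 * (m a : ℤ) ^ 2 + m a - (2 * l + 1) * (m a : ℤ)) := by
      linarith
    -- The rounding of `l² / 2` to its integer part happens here.
    omega
  have p2 : ∀ a ∈ Tᶜ, (2 * l + 1) * (m a : ℤ) - ((l : ℤ) + 1) ^ 2 / 2
      ≤ 2 * (m a : ℤ) ^ 2 - m a := by
    intro a _
    have h : 0 ≤ (2 * (m a : ℤ) - (l + 1)) ^ 2 := sq_nonneg _
    have h' : -(((l : ℤ) + 1) ^ 2) ≤ 2 * (2 * (m a : ℤ) ^ 2 - m a - (2 * l + 1) * (m a : ℤ)) := by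
      linarith
    omega
  -- Exactly one of `l`, `l + 1` is odd, so rounding gains exactly `1/2` in the sum.
  have hfl : (l : ℤ) ^ 2 / 2 + ((l : ℤ) + 1) ^ 2 / 2 = l * (l + 1) := by
    rcases Nat.even_or_odd' l with ⟨n, h | h⟩
    · have e1 : (l : ℤ) ^ 2 = 2 * (2 * n ^ 2) := by rw [h]; push_cast; ring
      have e2 : ((l : ℤ) + 1) ^ 2 = 2 * (2 * n ^ 2 + 2 * n) + 1 := by rw [h]; push_cast; ring
      have e3 : (l : ℤ) * (l + 1) = 4 * n ^ 2 + 2 * n := by rw [h]; push_cast; ring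
      omega
    · have e1 : (l : ℤ) ^ 2 = 2 * (2 * n ^ 2 + 2 * n) + 1 := by rw [h]; push_cast; ring
      have e2 : ((l : ℤ) + 1) ^ 2 = 2 * (2 * n ^ 2 + 4 * n + 2) := by rw [h]; push_cast; ring
      have e3 : (l : ℤ) * (l + 1) = 4 * n ^ 2 + 6 * n + 2 := by rw [h]; push_cast; ring
      omega
  have q1 := Finset.sum_le_sum p1
  have q2 := Finset.sum_le_sum p2
  simp only [Finset.sum_sub_distrib, Finset.sum_add_distrib, ← Finset.mul_sum, Finset.sum_const,
    nsmul_eq_mul, hTc, hT'] at q1 q2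
  have s1 := Finset.sum_add_sum_compl T fun a => (m a : ℤ)
  have s2 := Finset.sum_add_sum_compl T fun a => (m a : ℤ) ^ 2
  rw [hMc] at s1 ⊢
  -- `T` has one element fewer than its complement, so one copy of this term is left over and may be
  -- dropped.
  have hl2 : 0 ≤ (l : ℤ) ^ 2 / 2 := by positivity
  have hmain : (2 * l + 1) * (M : ℤ) - r * (l * (l + 1))
      ≤ 2 * (∑ a, (m a : ℤ) ^ 2) - M + 2 * ∑ a ∈ T, (m a : ℤ) := by
    rw [← hfl, ← s2]
    have : (2 * l + 1) * (M : ℤ) = (2 * l + 1) * (∑ a ∈ T, (m a : ℤ))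
      + (2 * l + 1) * (∑ a ∈ Tᶜ, (m a : ℤ)) := by rw [← s1]; ring
    linarith
  refine le_trans ?_ (mul_le_mul_of_nonneg_left hmain (Int.natCast_nonneg r))
  have hMz : (M : ℤ) = r * l + d := by rw [hMl]; push_cast; rfl
  have hdr : 0 ≤ (d : ℤ) * (r - d) := mul_nonneg (Int.natCast_nonneg d) (by omega)
  rw [hMz]
  linarith

variable {ι : Type*} [DecidableEq ι]

/-- Pair exponents of `∏_{χ i = χ j} |x_i² - x_j²|² / ∏ |x_i² - x_j²|^{1/r}`. -/
noncomputable def pairExponent (χ : ι → κ) (r : ℕ) (i j : ι) : ℝ :=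
  if i = j then 0 else (if χ i = χ j then 2 else 0) - 1 / (r : ℝ)

/-- Exponents of the single variables in `∏_{χ i ∈ T} |x_i|²`. -/
def singleExponent (χ : ι → κ) (T : Finset κ) (i : ι) : ℝ := if χ i ∈ T then 2 else 0

lemma sum_pairExponent (χ : ι → κ) (r : ℕ) (I : Finset ι) :
    ∑ i ∈ I, ∑ j ∈ I, pairExponent χ r i j
      = 2 * (∑ a, (({i ∈ I | χ i = a}.card : ℕ) : ℝ) ^ 2) - (I.card : ℝ) ^ 2 / r
        - I.card * (2 - 1 / r) := by
  have h : ∀ i ∈ I, ∑ j ∈ I, pairExponent χ r i j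
      = 2 * ({j ∈ I | χ j = χ i}.card : ℝ) - I.card / r - (2 - 1 / r) := by
    intro i hi
    have : ∀ j ∈ I, pairExponent χ r i j = (2 * (if χ j = χ i then 1 else 0) - 1 / (r : ℝ))
        - (if i = j then (2 - 1 / (r : ℝ)) else 0) := by
      intro j _
      unfold pairExponent
      by_cases hij : i = j
      · subst hij; simp
      · by_cases hχ : χ i = χ j
        · simp [hij, hχ]
        · simp [hij, hχ, Ne.symm hχ]
    rw [Finset.sum_congr rfl this, Finset.sum_sub_distrib, Finset.sum_sub_distrib,
      ← Finset.mul_sum, Finset.sum_boole, Finset.sum_ite_eq, if_pos hi, Finset.sum_const,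
      nsmul_eq_mul]
    ring
  rw [Finset.sum_congr rfl h, Finset.sum_sub_distrib, Finset.sum_sub_distrib, ← Finset.mul_sum,
    Finset.sum_const, Finset.sum_const, nsmul_eq_mul, nsmul_eq_mul,
    ← Finset.sum_fiberwise I χ fun i => ((({j ∈ I | χ j = χ i} : Finset ι).card : ℕ) : ℝ)]
  have : ∀ a, ∑ i ∈ I with χ i = a, ((({j ∈ I | χ j = χ i} : Finset ι).card : ℕ) : ℝ)
      = (({i ∈ I | χ i = a}.card : ℕ) : ℝ) ^ 2 := by
    intro a
    rw [Finset.sum_congr rfl (g := fun _ => (({i ∈ I | χ i = a}.card : ℕ) : ℝ))]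
    · rw [Finset.sum_const, nsmul_eq_mul, sq]
    · intro i hi
      rw [(Finset.mem_filter.1 hi).2]
  simp_rw [this]
  ring

lemma sum_singleExponent {ι κ : Type*} [DecidableEq κ] (χ : ι → κ) (T : Finset κ) (I : Finset ι) :
    ∑ i ∈ I, singleExponent χ T i = 2 * ∑ a ∈ T, (({i ∈ I | χ i = a}.card : ℕ) : ℝ) := by
  have h : ∀ i, singleExponent χ T i = ∑ a ∈ T, 2 * (if χ i = a then (1 : ℝ) else 0) := by
    intro i
    simp [singleExponent]
  simp_rw [h]
  rw [Finset.sum_comm, Finset.mul_sum]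
  refine Finset.sum_congr rfl fun a _ => ?_
  rw [← Finset.mul_sum, Finset.sum_boole]

/-- After clearing denominators this is `2r ∑ m_a² ≥ M² + 2r - 1`, with `k = 2r - 1` colours. -/
lemma pairExponent_power_counting (χ : ι → κ) (r : ℕ) (hr : 0 < r)
    (hκ : Fintype.card κ + 1 = 2 * r) (I : Finset ι) (hI : I.Nonempty) :
    -(2 * (1 - 1 / (2 * r : ℝ)) * ((I.card : ℝ) - 1))
      ≤ ∑ i ∈ I, ∑ j ∈ I, pairExponent χ r i j := by
  have hsum : ∑ a, ({i ∈ I | χ i = a}.card) = I.card :=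
    (Finset.card_eq_sum_card_fiberwise fun i _ => Finset.mem_univ (χ i)).symm
  have h := card_add_one_mul_sum_sq_ge (fun a => ({i ∈ I | χ i = a}.card))
    (by rw [hsum]; exact hI.card_pos) (by omega)
  have hsum' : ∑ a, (({i ∈ I | χ i = a}.card : ℕ) : ℤ) = I.card := by exact_mod_cast hsum
  rw [hsum'] at h
  have h' : (I.card : ℝ) ^ 2 + (2 * r - 1)
      ≤ 2 * r * ∑ a, (({i ∈ I | χ i = a}.card : ℕ) : ℝ) ^ 2 := by
    have e1 : (Fintype.card κ : ℤ) = 2 * r - 1 := by omega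
    rw [e1, sub_add_cancel] at h
    exact_mod_cast h
  rw [sum_pairExponent]
  have hr' : (0 : ℝ) < r := by exact_mod_cast hr
  generalize (∑ a, (({i ∈ I | χ i = a}.card : ℕ) : ℝ) ^ 2) = Q at *
  have : ((I.card : ℝ) ^ 2 + (2 * r - 1)) / r ≤ 2 * Q := by
    rw [div_le_iff₀ hr']; linarith
  have e : ((I.card : ℝ) ^ 2 + (2 * r - 1)) / r = (I.card : ℝ) ^ 2 / r + 2 - 1 / r := by
    field_simp; ring
  have e' : 2 * (1 - 1 / (2 * r : ℝ)) = 2 - 1 / r := by field_simp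
  rw [e']
  linarith

lemma signed_power_counting (χ : ι → κ) (T : Finset κ) (r : ℕ) (hr : 0 < r)
    (hT : T.card + 1 = r) (hκ : Fintype.card κ + 1 = 2 * r) (I : Finset ι) :
    -((1 - 1 / (2 * r : ℝ)) * (I.card : ℝ))
      ≤ (∑ i ∈ I, ∑ j ∈ I, pairExponent χ r i j) + ∑ i ∈ I, singleExponent χ T i := by
  have hsum : ∑ a, ({i ∈ I | χ i = a}.card) = I.card :=
    (Finset.card_eq_sum_card_fiberwise fun i _ => Finset.mem_univ (χ i)).symm
  have h := sq_sum_le_mul_signed_sum (fun a => ({i ∈ I | χ i = a}.card)) T r hr hT hκ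
  have hsum' : ∑ a, (({i ∈ I | χ i = a}.card : ℕ) : ℤ) = I.card := by exact_mod_cast hsum
  rw [hsum'] at h
  have h' : (I.card : ℝ) ^ 2
      ≤ r * (2 * (∑ a, (({i ∈ I | χ i = a}.card : ℕ) : ℝ) ^ 2) - I.card
        + 2 * ∑ a ∈ T, (({i ∈ I | χ i = a}.card : ℕ) : ℝ)) := by
    exact_mod_cast h
  rw [sum_pairExponent, sum_singleExponent]
  have hr' : (0 : ℝ) < r := by exact_mod_cast hr
  rw [mul_comm, ← div_le_iff₀ hr'] at h'
  -- The origin inequality holds with this amount to spare.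
  have hp : 0 ≤ (I.card : ℝ) * (1 / (2 * r)) := by positivity
  have e : (1 : ℝ) / r = 2 * (1 / (2 * r)) := by field_simp
  rw [e]
  linarith

end Counting

/-! ### Gap coordinates and the integrable majorant. -/

lemma MeasureTheory.Integrable.comp_linearEquiv {N : ℕ} {f : (Fin N → ℝ) → ℝ}
    (hf : Integrable f) (L : (Fin N → ℝ) ≃ₗ[ℝ] (Fin N → ℝ)) :
    Integrable fun x => f (L x) := by
  have hdet : LinearMap.det (L : (Fin N → ℝ) →ₗ[ℝ] (Fin N → ℝ)) ≠ 0 := L.isUnit_det'.ne_zero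
  have hmap := Measure.map_linearMap_addHaar_eq_smul_addHaar
    (volume : Measure (Fin N → ℝ)) hdet
  have hemb : MeasurableEmbedding (L : (Fin N → ℝ) → (Fin N → ℝ)) :=
    L.toContinuousLinearEquiv.toHomeomorph.measurableEmbedding
  refine (hemb.integrable_map_iff (μ := volume)).1 ?_
  have : Measure.map (L : (Fin N → ℝ) → (Fin N → ℝ)) volume
      = ENNReal.ofReal |(LinearMap.det (L : (Fin N → ℝ) →ₗ[ℝ] (Fin N → ℝ)))⁻¹| • volume := hmap
  rw [this]
  exact hf.smul_measure ENNReal.ofReal_ne_top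

section Gaps

variable {N : ℕ}

/-- The linear automorphism `u ↦ (∑_{g ≤ i} u_g)_i`. -/
noncomputable def partialSumEquiv (N : ℕ) : (Fin N → ℝ) ≃ₗ[ℝ] (Fin N → ℝ) :=
  LinearEquiv.ofInjectiveEndo
    { toFun := fun u i => ∑ g ∈ Finset.Iic i, u g
      map_add' := fun u v => by ext i; simp [Finset.sum_add_distrib]
      map_smul' := fun a u => by ext i; simp [Finset.mul_sum] } <| by
    rw [← LinearMap.ker_eq_bot, LinearMap.ker_eq_bot']
    intro u hu
    have hu' : ∀ i, ∑ g ∈ Finset.Iic i, u g = 0 := fun i => congrFun hu i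
    ext i
    induction i using WellFoundedLT.induction with
    | ind i ih =>
      have h := hu' i
      rw [← Finset.Iio_insert, Finset.sum_insert (by simp),
        Finset.sum_eq_zero fun g hg => ih g (Finset.mem_Iio.1 hg), add_zero] at h
      exact h

lemma partialSumEquiv_apply (u : Fin N → ℝ) (i : Fin N) :
    partialSumEquiv N u i = ∑ g ∈ Finset.Iic i, u g := rfl

lemma gap_pos_and_le {u y : Fin N → ℝ} (hy : ∀ i, y i = ∑ g ∈ Finset.Iic i, u g)
    (hmono : StrictMono y) (hpos : ∀ i, 0 < y i) (i : Fin N) : 0 < u i ∧ u i ≤ y i := by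
  have h := hy i
  rw [← Finset.Iio_insert, Finset.sum_insert (by simp)] at h
  obtain ⟨n, rfl⟩ : ∃ n, N = n + 1 := ⟨N - 1, by have := i.pos; omega⟩
  rcases Fin.eq_zero_or_eq_succ i with rfl | ⟨j, rfl⟩
  · have : Finset.Iio (0 : Fin (n + 1)) = ∅ := by ext g; simp
    rw [this, Finset.sum_empty, add_zero] at h
    exact ⟨h ▸ hpos 0, h.ge⟩
  · have : Finset.Iio j.succ = Finset.Iic j.castSucc := by
      ext g
      simp only [Finset.mem_Iio, Finset.mem_Iic, Fin.lt_def, Fin.le_def, Fin.val_succ,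
        Fin.val_castSucc]
      omega
    rw [this, ← hy] at h
    have h1 := hmono (Fin.castSucc_lt_succ (i := j))
    have h2 := hpos j.castSucc
    constructor <;> linarith

/-- The linear automorphism permuting the coordinates and changing the signs of some of them. -/
def signedPermEquiv (σ : Equiv.Perm (Fin N)) (s : Fin N → ℤˣ) :
    (Fin N → ℝ) ≃ₗ[ℝ] (Fin N → ℝ) :=
  (LinearEquiv.funCongrLeft ℝ ℝ σ).trans
    (LinearEquiv.piCongrRight fun i => LinearEquiv.smulOfUnit (R := ℝ) (M := ℝ)
      (Units.map (Int.castRingHom ℝ).toMonoidHom (s i)))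

lemma signedPermEquiv_apply (σ : Equiv.Perm (Fin N)) (s : Fin N → ℤˣ) (x : Fin N → ℝ)
    (i : Fin N) : signedPermEquiv σ s x i = ((s i : ℤ) : ℝ) * x (σ i) := rfl

lemma integrable_prod_indicator_rpow {c : ℝ} (hc : c < 1) (R : ℝ) :
    Integrable fun u : Fin N → ℝ =>
      ∏ i, (Set.Ioc 0 R).indicator (fun v : ℝ => v ^ (-c)) (u i) := by
  refine Integrable.fintype_prod (f := fun _ => (Set.Ioc 0 R).indicator (fun v : ℝ => v ^ (-c)))
    fun _ => ?_
  rw [integrable_indicator_iff measurableSet_Ioc]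
  rcases le_total 0 R with h | h
  · exact (intervalIntegrable_iff_integrableOn_Ioc_of_le h).1
      (intervalIntegral.intervalIntegrable_rpow' (by linarith))
  · simp [Set.Ioc_eq_empty (not_lt.2 h)]

/-- Local integrability criterion for type `B` products of powers `∏ |x_i² - x_j²|^{e_ij/2}
∏ |x_i|^{τ_i}`, the products being over all ordered pairs and all `i`. -/
lemma exists_integrable_bound (e : Fin N → Fin N → ℝ) (τ : Fin N → ℝ) (c : ℝ)
    (hc : 0 ≤ c) (hc1 : c < 1) (he : ∀ i, e i i = 0)
    (h1 : ∀ I : Finset (Fin N), I.Nonempty →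
      -(2 * c * ((I.card : ℝ) - 1)) ≤ ∑ i ∈ I, ∑ j ∈ I, e i j)
    (h2 : ∀ I : Finset (Fin N),
      -(c * (I.card : ℝ)) ≤ (∑ i ∈ I, ∑ j ∈ I, e i j) + ∑ i ∈ I, τ i)
    (R : ℝ) :
    ∃ G : (Fin N → ℝ) → ℝ, Integrable G ∧ (∀ x, 0 ≤ G x) ∧ ∀ x : Fin N → ℝ, (∀ i, |x i| ≤ R) →
      (∀ i, x i ≠ 0) → (∀ i j, i ≠ j → x i ^ 2 ≠ x j ^ 2) →
      Real.exp ((∑ i, ∑ j, e i j / 2 * Real.log |x i ^ 2 - x j ^ 2|)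
        + ∑ i, τ i * Real.log |x i|) ≤ G x := by
  have hbound : ∀ σ : Equiv.Perm (Fin N), ∃ C : ℝ, ∀ u : Fin N → ℝ,
      (∀ i, 0 < u i ∧ u i ≤ R) → ∀ y : Fin N → ℝ, (∀ i, y i = ∑ g ∈ Finset.Iic i, u g) →
      (∑ i, ∑ j, e (σ i) (σ j) / 2 * Real.log |y i ^ 2 - y j ^ 2|)
        + ∑ i, τ (σ i) * Real.log (y i) ≤ C - c * ∑ i, Real.log (u i) := by
    intro σ
    -- The counting hypotheses range over all subsets `I`, hence survive relabelling by `σ`.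
    refine exists_log_partial_sum_bound (fun i j => e (σ i) (σ j)) (fun i => τ (σ i)) c hc
      (fun i => he _) (fun I hI => ?_) (fun I => ?_) R
    · have := h1 (I.map σ.toEmbedding) (hI.map)
      simpa only [Finset.card_map, Finset.sum_map, Equiv.coe_toEmbedding] using this
    · have := h2 (I.map σ.toEmbedding)
      simpa only [Finset.card_map, Finset.sum_map, Equiv.coe_toEmbedding] using this
  choose C hC using hbound
  let H : (Fin N → ℝ) → ℝ := fun u =>
    ∏ i, (Set.Ioc 0 R).indicator (fun v : ℝ => v ^ (-c)) (u i)
  have hH0 : ∀ u, 0 ≤ H u := fun u => Finset.prod_nonneg fun i _ =>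
    Set.indicator_nonneg (fun v hv => Real.rpow_nonneg hv.1.le _) _
  let L : Equiv.Perm (Fin N) × (Fin N → ℤˣ) → ((Fin N → ℝ) ≃ₗ[ℝ] (Fin N → ℝ)) :=
    fun p => (signedPermEquiv p.1 p.2).trans (partialSumEquiv N).symm
  have hterm : ∀ p x, 0 ≤ Real.exp (C p.1) * H (L p x) := fun p x =>
    mul_nonneg (Real.exp_pos _).le (hH0 _)
  -- Summing over all signed permutations avoids selecting a chamber measurably: at each `x` the
  -- summand of its own chamber already gives the bound.
  refine ⟨fun x => ∑ p, Real.exp (C p.1) * H (L p x), ?_, ?_, ?_⟩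
  · exact integrable_finsetSum _ fun p _ =>
      ((integrable_prod_indicator_rpow hc1 R).comp_linearEquiv (L p)).const_mul _
  · exact fun x => Finset.sum_nonneg fun p _ => hterm p x
  · intro x hxR hx0 hx2
    let σ := Tuple.sort fun i => |x i|
    let s : Fin N → ℤˣ := fun i => if 0 ≤ x (σ i) then 1 else -1
    let y := signedPermEquiv σ s x
    have hyabs : ∀ i, y i = |x (σ i)| := by
      intro i
      simp only [y, signedPermEquiv_apply, s]
      split_ifs with h
      · simp [abs_of_nonneg h]
      · simp [abs_of_neg (not_le.1 h)]
    have hmono : StrictMono y := by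
      have hm : Monotone fun i => |x (σ i)| := Tuple.monotone_sort fun i => |x i|
      have hinj : Function.Injective fun i => |x (σ i)| := fun i j hij => by
        by_contra hne
        refine hx2 (σ i) (σ j) (fun h => hne (σ.injective h)) ?_
        rw [← sq_abs, ← sq_abs (x (σ j))]
        exact congrArg (· ^ 2) hij
      have : y = fun i => |x (σ i)| := funext hyabs
      rw [this]
      exact hm.strictMono_of_injective hinj
    have hpos : ∀ i, 0 < y i := fun i => by rw [hyabs]; exact abs_pos.2 (hx0 _)
    let u := L (σ, s) x
    have hyu : ∀ i, y i = ∑ g ∈ Finset.Iic i, u g := fun i => by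
      rw [← partialSumEquiv_apply]
      simp [u, L, y]
    have hu : ∀ i, 0 < u i ∧ u i ≤ R := fun i => by
      obtain ⟨a, b⟩ := gap_pos_and_le hyu hmono hpos i
      exact ⟨a, b.trans ((hyabs i).trans_le (hxR _))⟩
    refine le_trans ?_ (Finset.single_le_sum (fun p _ => hterm p x) (Finset.mem_univ (σ, s)))
    have hHu : H u = Real.exp (-(c * ∑ i, Real.log (u i))) := by
      rw [Finset.mul_sum, ← Finset.sum_neg_distrib, Real.exp_sum]
      refine Finset.prod_congr rfl fun i _ => ?_
      rw [Set.indicator_of_mem (show u i ∈ Set.Ioc 0 R from hu i), Real.rpow_def_of_pos (hu i).1]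
      congr 1; ring
    change _ ≤ Real.exp (C σ) * H u
    rw [hHu, ← Real.exp_add, ← sub_eq_add_neg, Real.exp_le_exp]
    refine le_trans (le_of_eq ?_) (hC σ u hu y hyu)
    simp only [hyabs, sq_abs]
    rw [← Equiv.sum_comp σ, ← Equiv.sum_comp σ fun i => τ i * Real.log |x i|]
    congr 1
    exact Finset.sum_congr rfl fun i _ => (Equiv.sum_comp σ _).symm

end Gaps

/-! ### Blocks as a colouring of the variables. -/

section Blocks

lemma exists_blockColoring (N : ℕ) {k : ℕ} (ν : Fin k → ℕ) (hν : ∑ j, ν j = N) :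
    ∃ χ : Fin N → Fin k, ∀ i j, i ∈ partBlock N ν j ↔ χ i = j := by
  have hex : ∀ i : Fin N, ∃ j, i ∈ partBlock N ν j := by
    intro i
    obtain ⟨n, rfl⟩ : ∃ n, k = n + 1 := by
      rcases k with _ | n
      · simp at hν; exact absurd i.pos (by omega)
      · exact ⟨n, rfl⟩
    have hlast : (i : ℕ) < ∑ a ∈ Finset.Iic (Fin.last n), ν a := by
      have : Finset.Iic (Fin.last n) = Finset.univ := by ext a; simp [Fin.le_last]
      rw [this, hν]; exact i.isLt
    let J : Finset (Fin (n + 1)) := {j | (i : ℕ) < ∑ a ∈ Finset.Iic j, ν a}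
    have hJ : J.Nonempty := ⟨Fin.last n, by simpa [J] using hlast⟩
    -- The colour of `i` is the first block that ends beyond `i`. By minimality the preceding block
    -- ends at or before `i`.
    refine ⟨J.min' hJ, ?_⟩
    have hm : (i : ℕ) < ∑ a ∈ Finset.Iic (J.min' hJ), ν a := by
      simpa [J] using J.min'_mem hJ
    simp only [partBlock, Finset.mem_filter, Finset.mem_univ, true_and]
    refine ⟨?_, hm⟩
    rcases Fin.eq_zero_or_eq_succ (J.min' hJ) with h0 | ⟨j, hj⟩
    · rw [h0]
      have : Finset.Iio (0 : Fin (n + 1)) = ∅ := by ext g; simp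
      simp [this]
    · rw [hj]
      have : Finset.Iio j.succ = Finset.Iic j.castSucc := by
        ext g
        simp only [Finset.mem_Iio, Finset.mem_Iic, Fin.lt_def, Fin.le_def, Fin.val_succ,
          Fin.val_castSucc]
        omega
      rw [this]
      by_contra hlt
      have hmem : j.castSucc ∈ J := by simpa [J] using hlt
      have := J.min'_le _ hmem
      rw [hj] at this
      exact absurd this (not_le.2 Fin.castSucc_lt_succ)
  choose χ hχ using hex
  refine ⟨χ, fun i j => ⟨fun hj => ?_, fun h => h ▸ hχ i⟩⟩
  have aux : ∀ a b : Fin k, i ∈ partBlock N ν a → i ∈ partBlock N ν b → ¬ a < b := by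
    intro a b ha hb hab
    simp only [partBlock, Finset.mem_filter, Finset.mem_univ, true_and] at ha hb
    have : ∑ x ∈ Finset.Iic a, ν x ≤ ∑ x ∈ Finset.Iio b, ν x :=
      Finset.sum_le_sum_of_subset fun x hx =>
        Finset.mem_Iio.2 ((Finset.mem_Iic.1 hx).trans_lt hab)
    omega
  exact le_antisymm (not_lt.1 (aux j _ hj (hχ i))) (not_lt.1 (aux _ j (hχ i) hj))

lemma sum_balancedPart (N k : ℕ) (hk : 0 < k) : ∑ j, balancedPart N k j = N := by
  have h : ∀ j : Fin k, balancedPart N k j = N / k + if (j : ℕ) < N % k then 1 else 0 := by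
    intro j; unfold balancedPart; split_ifs <;> simp
  have hc : ({j : Fin k | (j : ℕ) < N % k} : Finset (Fin k)).card = N % k := by
    have := Fin.card_filter_val_lt (n := k) (m := N % k)
    rw [this, min_eq_right (Nat.mod_lt N hk).le]
  simp_rw [h]
  rw [Finset.sum_add_distrib, Finset.sum_const, Finset.card_univ, Fintype.card_fin,
    Finset.sum_boole, hc, smul_eq_mul]
  exact Nat.div_add_mod N k

lemma card_lastIndices (k s : ℕ) (h : s ≤ k) : (lastIndices k s).card = s := by
  have h1 := Finset.card_add_card_compl (lastIndices k s)
  have h2 : (lastIndices k s)ᶜ = ({j : Fin k | (j : ℕ) < k - s} : Finset (Fin k)) := by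
    ext j; simp [lastIndices]; omega
  rw [h2, Fin.card_filter_val_lt, Fintype.card_fin, min_eq_right (Nat.sub_le k s)] at h1
  omega

end Blocks

/-! ### The quotient on generators and on the ideal. -/

section Quotient

variable {N : ℕ}

lemma sum_sum_eq_two_mul_sum_lt (f : Fin N → Fin N → ℝ) (hs : ∀ i j, f i j = f j i)
    (hd : ∀ i, f i i = 0) :
    ∑ i, ∑ j, f i j = 2 * ∑ p : Fin N × Fin N with p.1 < p.2, f p.1 p.2 := by
  have h : ∀ p : Fin N × Fin N, f p.1 p.2
      = (if p.1 < p.2 then f p.1 p.2 else 0) + (if p.2 < p.1 then f p.2 p.1 else 0) := by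
    rintro ⟨i, j⟩
    rcases lt_trichotomy i j with h | h | h
    · simp [h, h.not_gt]
    · simp [h, hd]
    · simp [h, h.not_gt, hs i j]
  rw [← Fintype.sum_prod_type', Finset.sum_congr rfl fun p _ => h p, Finset.sum_add_distrib,
    Finset.sum_filter, two_mul]
  congr 1
  exact Fintype.sum_equiv (Equiv.prodComm _ _) _ _ fun p => rfl

lemma eval_partPolyT {k : ℕ} (ν : Fin k → ℕ) (T : Finset (Fin k)) (z : Fin N → ℂ) :
    eval z (partPolyT N ν T)
      = (∏ j, ∏ p ∈ partBlock N ν j ×ˢ partBlock N ν j with p.1 < p.2, (z p.1 ^ 2 - z p.2 ^ 2))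
        * ∏ j ∈ T, ∏ i ∈ partBlock N ν j, z i := by
  simp [partPolyT, partPoly, vandermondeOn, map_prod]

lemma norm_ofReal_sq_sub_sq (a b : ℝ) : ‖(a : ℂ) ^ 2 - (b : ℂ) ^ 2‖ = |a ^ 2 - b ^ 2| := by
  rw [← Real.norm_eq_abs, ← Complex.norm_real]
  push_cast
  rfl

lemma log_norm_partPolyT {k : ℕ} (ν : Fin k → ℕ) (T : Finset (Fin k)) (χ : Fin N → Fin k)
    (hχ : ∀ i j, i ∈ partBlock N ν j ↔ χ i = j) (x : Fin N → ℝ) (hx0 : ∀ i, x i ≠ 0)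
    (hx2 : ∀ i j, i ≠ j → x i ^ 2 ≠ x j ^ 2) :
    Real.log ‖eval (fun i => (x i : ℂ)) (partPolyT N ν T)‖
      = (∑ p : Fin N × Fin N with p.1 < p.2,
          (if χ p.1 = χ p.2 then 1 else 0) * Real.log |x p.1 ^ 2 - x p.2 ^ 2|)
        + (∑ i, (if χ i ∈ T then 1 else 0) * Real.log |x i|) := by
  have hne : ∀ p : Fin N × Fin N, p.1 < p.2 → |x p.1 ^ 2 - x p.2 ^ 2| ≠ 0 := fun p hp =>
    abs_ne_zero.2 (sub_ne_zero.2 (hx2 _ _ hp.ne))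
  have hne' : ∀ i, |x i| ≠ 0 := fun i => abs_ne_zero.2 (hx0 i)
  have hblock : ∀ j, partBlock N ν j = ({i | χ i = j} : Finset (Fin N)) := fun j => by
    ext i; simp [hχ]
  rw [eval_partPolyT, norm_mul, norm_prod, norm_prod]
  simp_rw [norm_prod, norm_ofReal_sq_sub_sq, Complex.norm_real, Real.norm_eq_abs]
  rw [Real.log_mul, Real.log_prod, Real.log_prod]
  · congr 1
    · have : ∀ j, Real.log (∏ p ∈ partBlock N ν j ×ˢ partBlock N ν j with p.1 < p.2,
          |x p.1 ^ 2 - x p.2 ^ 2|) = ∑ p : Fin N × Fin N with p.1 < p.2,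
          if χ p.1 = j ∧ χ p.2 = j then Real.log |x p.1 ^ 2 - x p.2 ^ 2| else 0 := by
        intro j
        rw [Real.log_prod fun p hp => hne p (Finset.mem_filter.1 hp).2, ← Finset.sum_filter]
        refine Finset.sum_congr ?_ fun _ _ => rfl
        ext p
        simp [hχ, and_comm]
      simp_rw [this]
      rw [Finset.sum_comm]
      refine Finset.sum_congr rfl fun p _ => ?_
      by_cases h : χ p.1 = χ p.2
      · simp [h]
      · simp only [h, if_false, zero_mul]
        refine Finset.sum_eq_zero fun j _ => if_neg ?_
        rintro ⟨h1, h2⟩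
        exact h (h1.trans h2.symm)
    · have : ∀ j, Real.log (∏ i ∈ partBlock N ν j, |x i|)
          = ∑ i, if χ i = j then Real.log |x i| else 0 := fun j => by
        rw [Real.log_prod fun i _ => hne' i, hblock, Finset.sum_filter]
      simp_rw [this]
      rw [Finset.sum_comm]
      refine Finset.sum_congr rfl fun i _ => ?_
      simp
  · exact fun j _ => Finset.prod_ne_zero_iff.2 fun i _ => hne' i
  · exact fun j _ => Finset.prod_ne_zero_iff.2 fun p hp => hne p (Finset.mem_filter.1 hp).2
  · exact Finset.prod_ne_zero_iff.2 fun j _ => Finset.prod_ne_zero_iff.2 fun p hp =>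
      hne p (Finset.mem_filter.1 hp).2
  · exact Finset.prod_ne_zero_iff.2 fun j _ => Finset.prod_ne_zero_iff.2 fun i _ => hne' i

/-- The denominator `∏_{i<j} (x_i² - x_j²)^{1/(2r)}`. -/
noncomputable def dTypeDenominator (r : ℕ) (x : Fin N → ℝ) : ℂ :=
  ∏ p : Fin N × Fin N with p.1 < p.2,
    ((x p.1 : ℂ) ^ 2 - (x p.2 : ℂ) ^ 2) ^ ((1 : ℂ) / (2 * (r : ℂ)))

lemma log_norm_dTypeDenominator (r : ℕ) (x : Fin N → ℝ)
    (hx2 : ∀ i j, i ≠ j → x i ^ 2 ≠ x j ^ 2) :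
    Real.log ‖dTypeDenominator r x‖
      = 1 / (2 * r) * ∑ p : Fin N × Fin N with p.1 < p.2, Real.log |x p.1 ^ 2 - x p.2 ^ 2| := by
  have hpos : ∀ p : Fin N × Fin N, p.1 < p.2 → 0 < |x p.1 ^ 2 - x p.2 ^ 2| := fun p hp =>
    abs_pos.2 (sub_ne_zero.2 (hx2 _ _ hp.ne))
  have hexp : (1 : ℂ) / (2 * (r : ℂ)) = ((1 / (2 * r) : ℝ) : ℂ) := by push_cast; rfl
  have hn : ∀ p : Fin N × Fin N,
      ‖((x p.1 : ℂ) ^ 2 - (x p.2 : ℂ) ^ 2) ^ ((1 : ℂ) / (2 * (r : ℂ)))‖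
        = |x p.1 ^ 2 - x p.2 ^ 2| ^ (1 / (2 * r) : ℝ) := fun p => by
    rw [hexp, Complex.norm_cpow_real, norm_ofReal_sq_sub_sq]
  rw [dTypeDenominator, norm_prod]
  simp_rw [hn]
  rw [Real.log_prod fun p hp => (Real.rpow_pos_of_pos (hpos p (Finset.mem_filter.1 hp).2) _).ne',
    Finset.mul_sum]
  exact Finset.sum_congr rfl fun p hp => Real.log_rpow (hpos p (Finset.mem_filter.1 hp).2) _

lemma dTypeDenominator_ne_zero_iff (r : ℕ) (hr : 0 < r) (x : Fin N → ℝ) :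
    dTypeDenominator r x ≠ 0 ↔ ∀ i j, i ≠ j → x i ^ 2 ≠ x j ^ 2 := by
  have hr' : (1 : ℂ) / (2 * (r : ℂ)) ≠ 0 := by
    have : (r : ℂ) ≠ 0 := by exact_mod_cast hr.ne'
    exact one_div_ne_zero (mul_ne_zero two_ne_zero this)
  rw [dTypeDenominator, Finset.prod_ne_zero_iff]
  have hz : ∀ p : Fin N × Fin N,
      ((x p.1 : ℂ) ^ 2 - (x p.2 : ℂ) ^ 2) ^ ((1 : ℂ) / (2 * (r : ℂ))) ≠ 0
        ↔ x p.1 ^ 2 ≠ x p.2 ^ 2 := fun p => by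
    rw [Ne, Complex.cpow_eq_zero_iff, not_and_or, not_not, or_iff_left hr', sub_eq_zero]
    exact_mod_cast Iff.rfl
  simp only [Finset.mem_filter, Finset.mem_univ, true_and, hz]
  constructor
  · intro h i j hij
    rcases lt_or_gt_of_ne hij with hlt | hlt
    · exact h (i, j) hlt
    · exact (h (j, i) hlt).symm
  · exact fun h p hp => h _ _ hp.ne

/-- With principal values the denominator itself need not be symmetric, but its modulus depends only
on the `|x_i² - x_j²|`. -/
lemma norm_dTypeDenominator_comp_perm (r : ℕ) (hr : 0 < r) (x : Fin N → ℝ)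
    (σ : Equiv.Perm (Fin N)) : ‖dTypeDenominator r (x ∘ σ)‖ = ‖dTypeDenominator r x‖ := by
  by_cases h : dTypeDenominator r x = 0
  · have : dTypeDenominator r (x ∘ σ) = 0 := by
      by_contra h'
      refine (dTypeDenominator_ne_zero_iff r hr x).2 (fun i j hij => ?_) h
      have := (dTypeDenominator_ne_zero_iff r hr _).1 h' (σ.symm i) (σ.symm j)
        fun h => hij (σ.symm.injective h)
      simpa using this
    rw [h, this]
  · have hx := (dTypeDenominator_ne_zero_iff r hr x).1 h
    have hx' : ∀ i j, i ≠ j → (x ∘ σ) i ^ 2 ≠ (x ∘ σ) j ^ 2 := fun i j hij =>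
      hx _ _ fun h => hij (σ.injective h)
    have h' := (dTypeDenominator_ne_zero_iff r hr _).2 hx'
    refine Real.log_injOn_pos (norm_pos_iff.2 h') (norm_pos_iff.2 h) ?_
    rw [log_norm_dTypeDenominator r _ hx, log_norm_dTypeDenominator r _ hx']
    congr 1
    have hsum : ∀ z : Fin N → ℝ, ∑ i, ∑ j, Real.log |z i ^ 2 - z j ^ 2|
        = 2 * ∑ p : Fin N × Fin N with p.1 < p.2, Real.log |z p.1 ^ 2 - z p.2 ^ 2| := fun z =>
      sum_sum_eq_two_mul_sum_lt (fun i j => Real.log |z i ^ 2 - z j ^ 2|)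
        (fun i j => by rw [abs_sub_comm]) (fun i => by simp)
    have e1 := hsum x
    have e2 := hsum (x ∘ σ)
    have e3 : ∑ i, ∑ j, Real.log |(x ∘ σ) i ^ 2 - (x ∘ σ) j ^ 2|
        = ∑ i, ∑ j, Real.log |x i ^ 2 - x j ^ 2| := by
      rw [← Equiv.sum_comp σ fun i => ∑ j, Real.log |x i ^ 2 - x j ^ 2|]
      exact Finset.sum_congr rfl fun i _ =>
        Equiv.sum_comp σ fun j => Real.log |x (σ i) ^ 2 - x j ^ 2|
    linarith

lemma norm_sq_dTypeQuotient_partPolyT (r : ℕ) (hr : 0 < r) {k : ℕ} (ν : Fin k → ℕ)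
    (T : Finset (Fin k)) (χ : Fin N → Fin k)
    (hχ : ∀ i j, i ∈ partBlock N ν j ↔ χ i = j) (x : Fin N → ℝ) (hx0 : ∀ i, x i ≠ 0)
    (hx2 : ∀ i j, i ≠ j → x i ^ 2 ≠ x j ^ 2) :
    ‖dTypeQuotient r (partPolyT N ν T) x‖ ^ 2
      = Real.exp ((∑ i, ∑ j, pairExponent χ r i j / 2 * Real.log |x i ^ 2 - x j ^ 2|)
        + ∑ i, singleExponent χ T i * Real.log |x i|) := by
  have hnum : eval (fun i => (x i : ℂ)) (partPolyT N ν T) ≠ 0 := by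
    rw [eval_partPolyT]
    refine mul_ne_zero (Finset.prod_ne_zero_iff.2 fun j _ => Finset.prod_ne_zero_iff.2
      fun p hp => ?_) (Finset.prod_ne_zero_iff.2 fun j _ => Finset.prod_ne_zero_iff.2
      fun i _ => by exact_mod_cast hx0 i)
    have := hx2 _ _ (Finset.mem_filter.1 hp).2.ne
    rw [sub_ne_zero]
    exact_mod_cast this
  have hden := (dTypeDenominator_ne_zero_iff r hr x).2 hx2
  have hq : dTypeQuotient r (partPolyT N ν T) x
      = eval (fun i => (x i : ℂ)) (partPolyT N ν T) / dTypeDenominator r x := rfl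
  have hpos : 0 < ‖dTypeQuotient r (partPolyT N ν T) x‖ ^ 2 := by
    rw [hq]; exact pow_pos (norm_pos_iff.2 (div_ne_zero hnum hden)) 2
  rw [← Real.exp_log hpos, Real.log_pow, hq, norm_div,
    Real.log_div (norm_ne_zero_iff.2 hnum) (norm_ne_zero_iff.2 hden),
    log_norm_partPolyT ν T χ hχ x hx0 hx2, log_norm_dTypeDenominator r x hx2,
    sum_sum_eq_two_mul_sum_lt _ ?_ ?_]
  · congr 1
    have e1 : ∀ p ∈ ({p | p.1 < p.2} : Finset (Fin N × Fin N)),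
        pairExponent χ r p.1 p.2 / 2 * Real.log |x p.1 ^ 2 - x p.2 ^ 2|
        = (if χ p.1 = χ p.2 then 1 else 0) * Real.log |x p.1 ^ 2 - x p.2 ^ 2|
          - 1 / (2 * r) * Real.log |x p.1 ^ 2 - x p.2 ^ 2| := by
      intro p hp
      rw [pairExponent, if_neg (Finset.mem_filter.1 hp).2.ne]
      split_ifs <;> field_simp
      simp
    have e2 : ∀ i, singleExponent χ T i * Real.log |x i|
        = 2 * ((if χ i ∈ T then 1 else 0) * Real.log |x i|) := by
      intro i; unfold singleExponent; split_ifs <;> ring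
    rw [Finset.sum_congr rfl e1, Finset.sum_congr rfl fun i _ => e2 i, Finset.sum_sub_distrib,
      ← Finset.mul_sum, ← Finset.mul_sum]
    push_cast
    ring
  · intro i j
    simp only [pairExponent, eq_comm, abs_sub_comm]
  · intro i
    simp [pairExponent]

lemma measurable_dTypeQuotient (r : ℕ) (f : MvPolynomial (Fin N) ℂ) :
    Measurable (dTypeQuotient r f) := by
  unfold dTypeQuotient
  have hf : Continuous fun x : Fin N → ℝ => eval (fun i => (x i : ℂ)) f :=
    (MvPolynomial.continuous_eval f).comp (by fun_prop)
  refine hf.measurable.div ?_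
  fun_prop

lemma ae_coord_ne_zero : ∀ᵐ x : Fin N → ℝ, ∀ i, x i ≠ 0 :=
  ae_all_iff.2 fun i => Measure.ae_eval_ne (μ := fun _ : Fin N => (volume : Measure ℝ)) i 0

lemma memLp_rename_partPolyT (r : ℕ) (hr : 0 < r) {k : ℕ} (hk : k + 1 = 2 * r) (ν : Fin k → ℕ)
    (hν : ∑ j, ν j = N) (T : Finset (Fin k)) (hT : T.card + 1 = r) (σ : Equiv.Perm (Fin N))
    (R : ℝ) :
    MemLp (dTypeQuotient r (rename σ (partPolyT N ν T))) 2
      (volume.restrict (Metric.closedBall 0 R)) := by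
  obtain ⟨χ, hχ⟩ := exists_blockColoring N ν hν
  have hr1 : (1 : ℝ) ≤ r := by exact_mod_cast hr
  have hc1 : 1 / (2 * r : ℝ) ≤ 1 := by rw [div_le_one (by positivity)]; linarith
  have hc0 : 0 < 1 / (2 * r : ℝ) := by positivity
  have hκ : Fintype.card (Fin k) + 1 = 2 * r := by rw [Fintype.card_fin, hk]
  obtain ⟨G, hG, hG0, hGb⟩ := exists_integrable_bound (pairExponent χ r) (singleExponent χ T)
    (1 - 1 / (2 * r : ℝ)) (by linarith) (by linarith) (fun i => by simp [pairExponent])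
    (fun I hI => pairExponent_power_counting χ r hr hκ I hI)
    (fun I => signed_power_counting χ T r hr hT hκ I) R
  have hG' : Integrable fun x : Fin N → ℝ => G (x ∘ σ) :=
    hG.comp_linearEquiv (LinearEquiv.funCongrLeft ℝ ℝ σ)
  rw [memLp_two_iff_integrable_sq_norm (measurable_dTypeQuotient r _).aestronglyMeasurable]
  refine hG'.restrict.mono' ((measurable_dTypeQuotient r _).norm.pow_const 2).aestronglyMeasurable
    ?_
  rw [ae_restrict_iff' Metric.isClosed_closedBall.measurableSet]
  filter_upwards [ae_coord_ne_zero] with x hx0 hxR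
  have hxR' : ∀ i, |x i| ≤ R := fun i =>
    (norm_le_pi_norm x i).trans (mem_closedBall_zero_iff.1 hxR)
  have hq : ∀ f z, dTypeQuotient r f z
      = eval (fun i => (z i : ℂ)) f / dTypeDenominator (N := N) r z := fun _ _ => rfl
  have hnorm : ‖dTypeQuotient r (rename σ (partPolyT N ν T)) x‖
      = ‖dTypeQuotient r (partPolyT N ν T) (x ∘ σ)‖ := by
    rw [hq, hq, norm_div, norm_div, norm_dTypeDenominator_comp_perm r hr, eval_rename]
    rfl
  rw [Real.norm_of_nonneg (by positivity), hnorm]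
  -- Where the denominator vanishes, division by zero gives the value `0`, so only the coordinate
  -- hyperplanes have to be discarded as a null set.
  by_cases hd : dTypeDenominator r (x ∘ σ) = 0
  · rw [hq, hd, div_zero, norm_zero, zero_pow two_ne_zero]
    exact hG0 _
  · have hx2 := (dTypeDenominator_ne_zero_iff r hr _).1 hd
    rw [norm_sq_dTypeQuotient_partPolyT r hr ν T χ hχ (x ∘ σ) (fun i => hx0 _) hx2]
    exact hGb (x ∘ σ) (fun i => hxR' _) (fun i => hx0 _) hx2

lemma memLp_dTypeQuotient_of_mem_idealKPart (r : ℕ) (hr : 0 < r) {k : ℕ} (hk : k + 1 = 2 * r)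
    (ν : Fin k → ℕ) (hν : ∑ j, ν j = N) (T : Finset (Fin k)) (hT : T.card + 1 = r)
    (f : MvPolynomial (Fin N) ℂ) (hf : f ∈ idealKPart N ν T) (R : ℝ) :
    MemLp (dTypeQuotient r f) 2 (volume.restrict (Metric.closedBall 0 R)) := by
  induction hf using Submodule.span_induction with
  | mem f hf =>
    obtain ⟨σ, rfl⟩ := hf
    exact memLp_rename_partPolyT r hr hk ν hν T hT σ R
  | zero =>
    have : dTypeQuotient r (0 : MvPolynomial (Fin N) ℂ) = 0 := by
      ext x; simp [dTypeQuotient]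
    rw [this]
    exact MemLp.zero
  | add f g _ _ hf hg =>
    have : dTypeQuotient r (f + g) = dTypeQuotient r f + dTypeQuotient r g := by
      ext x; simp [dTypeQuotient, add_div]
    rw [this]
    exact hf.add hg
  | smul a f _ hf =>
    have ha : Continuous fun x : Fin N → ℝ => eval (fun i => (x i : ℂ)) a :=
      (MvPolynomial.continuous_eval a).comp (by fun_prop)
    obtain ⟨C, hC⟩ := (isCompact_closedBall (0 : Fin N → ℝ) R).exists_bound_of_continuousOn
      ha.continuousOn
    refine hf.of_le_mul (c := C) (measurable_dTypeQuotient r _).aestronglyMeasurable ?_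
    rw [ae_restrict_iff' Metric.isClosed_closedBall.measurableSet]
    refine Filter.Eventually.of_forall fun x hx => ?_
    have : dTypeQuotient r (a • f) x
        = eval (fun i => (x i : ℂ)) a * dTypeQuotient r f x := by
      simp [dTypeQuotient, mul_div_assoc]
    rw [this, norm_mul]
    exact mul_le_mul_of_nonneg_right (hC x hx) (norm_nonneg _)

end Quotient

theorem mainTheorem2 (N r : ℕ) (hr : 0 < r) (hrN : 2 * r ≤ N)
    (f : MvPolynomial (Fin N) ℂ) (hf : f ∈ idealK N (2 * r - 1)) :
    LocallyL2 (dTypeQuotient r f) := by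
  intro P
  refine ⟨Metric.closedBall 0 (‖P‖ + 1), ?_, ?_⟩
  · refine Filter.mem_of_superset (Metric.ball_mem_nhds P one_pos) fun x hx => ?_
    rw [mem_closedBall_zero_iff]
    have h1 : ‖x - P‖ < 1 := by rwa [← dist_eq_norm]
    have h2 := norm_sub_norm_le x P
    linarith
  · refine memLp_dTypeQuotient_of_mem_idealKPart r hr (by omega) _
      (sum_balancedPart N (2 * r - 1) (by omega)) _ ?_ f hf _
    -- Here `s = ((2r - 1) - 1) / 2 = r - 1`.
    rw [card_lastIndices _ _ (by omega)]
    omega
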